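/- Let $a_i, b_j \in [0,1]$ ($i,j\ge 1$) be such that $0<a_ib_j<1$ for all $i,j$, and let $\omega(i,j)$ be independent random variables with $\mathbb P(\omega(i,j)=k)=(1-a_ib_j)(a_ib_j)^k$, $k=0,1,2,\dots$. Let $x_1\le x_2\le\cdots$ be integers and let $c\in\mathbb Z\cup\{-\infty\}$ satisfy $c\le x_1$ (for instance $c=-\infty$, or $c=0$ if $x_1\ge 0$). Define, for $m,n\ge 1$, $$G(m,n)=\max\{G(m-1,n),\,G(m,n-1)\}+\omega(m,n),$$ with boundary values $G(m,0)=c$ for $m\ge 1$ and $G(0,n)=x_n$ for $n\ge 1$. For a given $N$ put $\vec G(m)=(G(m,1),\dots,G(m,N))$ and $\mathbb W_N=\{z\in\mathbb Z^N: z_1\le z_2\le\cdots\le z_N\}$. Then $\vec G$ takes values in $\mathbb W_N$ and is an (inhomogeneous) Markov chain: for $0\le\ell\le m$, whenever $\mathbb P(\vec G(0)=u_0,\dots,\vec G(\ell)=u_\ell)>0$, $$\mathbb P(\vec G(m)=y\mid \vec G(0)=u_0,\dots,\vec G(\ell)=u_\ell)=\mathbb P(\vec G(m)=y\mid \vec G(\ell)=u_\ell).$$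 Moreover, with $x=(x_1,\dots,x_N)$, for every $m\ge 0$, every $y\in\mathbb W_N$ and every $R>\max\{1/b_1,\dots,1/b_N\}$, $$\mathbb P(\vec G(m)=y\mid \vec G(0)=x)=\det\big[M(i,j\mid x,y)\big]_{i,j=1}^N,$$ $$M(i,j\mid x,y)=\frac1{2\pi \mathbf i}\oint_{|z|=R}\frac{dz}{z}\,\frac{(zb_j)^{y_j}}{(zb_i)^{x_i}}\,\frac{\prod_{k=1}^{j}(z-1/b_k)}{\prod_{k=1}^{i}(z-1/b_k)}\prod_{k=1}^m\frac{1-a_kb_j}{1-a_k/z},$$ the circle being oriented counter-clockwise. More generally, for $\ell,m\ge 0$ and $u,y\in\mathbb W_N$ with $\mathbb P(\vec G(\ell)=u)>0$, the probability $\mathbb P(\vec G(\ell+m)=y\mid \vec G(\ell)=u)$ is given by the same determinant with $x$ replaced by $u$ and $a_1,\dots,a_m$ replaced by $a_{\ell+1},\dots,a_{\ell+m}$. -/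

import Mathlib

open MeasureTheory ProbabilityTheory

/-- The Weyl chamber `{z ∈ ℤ^N : z₁ ≤ z₂ ≤ ⋯ ≤ z_N}`. -/
def weylChamber (N : ℕ) : Set (Fin N → ℤ) :=
  {z | Monotone z}

/-- `max {c, k}` for a boundary value `c ∈ ℤ ∪ {-∞}` and `k ∈ ℤ`. -/
def maxBoundary (c : WithBot ℤ) (k : ℤ) : ℤ :=
  WithBot.recBotCoe k (fun d : ℤ => max d k) c

/-- The growth function `G(m, n) = max {G(m-1, n), G(m, n-1)} + w(m, n)` with boundary values
`G(m, 0) = c` for `m ≥ 1` and `G(0, n) = x_n` for `n ≥ 1`.  All indices that start at `1` in the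
usual notation are shifted to start at `0`, except for the time `m`: `growth c x w m n` is
`G(m, n+1)`, `x n` is `x_{n+1}`, and `w i j` is the weight at `(i+1, j+1)`. -/
def growth (c : WithBot ℤ) (x : ℕ → ℤ) (w : ℕ → ℕ → ℕ) : ℕ → ℕ → ℤ
  | 0, n => x n
  | m + 1, 0 => maxBoundary c (growth c x w m 0) + (w m 0 : ℤ)
  | m + 1, n + 1 => max (growth c x w m (n + 1)) (growth c x w (m + 1) n) + (w m (n + 1) : ℤ)

/-- The vector `(G(m, 1), …, G(m, N))`. -/
def growthVec (N : ℕ) (c : WithBot ℤ) (x : ℕ → ℤ) (w : ℕ → ℕ → ℕ) (m : ℕ) : Fin N → ℤ :=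
  fun j => growth c x w m j

/-- The matrix `M(i, j | x, y)` of contour integrals over the circle `|z| = R`, for `m` time steps
with parameters `a₁, …, a_m` (here `a 0, …, a (m-1)`) and `b₁, …, b_N` (here `b 0, …, b (N-1)`).
A product over `k = 1, …, j` becomes one over `Finset.range (j + 1)` after the index shift. -/
noncomputable def transitionMatrix (N : ℕ) (a b : ℕ → ℝ) (R : ℝ) (m : ℕ) (x y : Fin N → ℤ) :
    Matrix (Fin N) (Fin N) ℂ :=
  Matrix.of fun i j =>
    (2 * (Real.pi : ℂ) * Complex.I)⁻¹ *
      ∮ z in C(0, R),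
        1 / z * ((z * (b j : ℂ)) ^ (y j) / (z * (b i : ℂ)) ^ (x i)) *
          ((∏ k ∈ Finset.range ((j : ℕ) + 1), (z - 1 / (b k : ℂ))) /
            (∏ k ∈ Finset.range ((i : ℕ) + 1), (z - 1 / (b k : ℂ)))) *
          ∏ k ∈ Finset.range m, ((1 - (a k : ℂ) * (b j : ℂ)) / (1 - (a k : ℂ) / z))

/-! Reading a row from left to right, a step from `v` to `y` happens exactly when the weight at each
site `j` equals `y_j - max(v_j, y_{j-1})` (`growthVec_succ_eq_iff`), so one-step probabilities are
explicit products. It remains to see that the determinants are `δ_{x,y}` at time `0` and satisfy the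
forward equation.

After endpoint factors are removed, the entries are contour integrals `φ_j(y_j)`. Raising `j`
multiplies the integrand by `z - 1/b_{j+1}`, a difference operator in `y_j`; raising the time
divides it by `1 - a/z`, a geometric summation. For the forward equation (`sum_det_mul_stepWeight`)
the step weights are absorbed into the columns. Non-monotone vectors may then be added for free:
summing `v_j` below `v_{j-1}` telescopes to a multiple of column `j-1`
(`AlternatingMap.sum_monotone_eq`). The columns can now be summed independently, and each sum is the
new column minus a multiple of the preceding new one. The initial condition
(`det_eq_ite_of_vanishing`) holds because the integral vanishes when the integrand decays fast at
infinity or is entire.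

Since a row of weights is independent of the past, the induction on time works jointly with any past
event `B` on which the present state is `u` (`measureReal_inter_growthVec_eq`). The conditional
probability depends on `B` only through `u`, which gives the formula and the Markov property
together. -/

/-! ### Alternating sums over monotone vectors -/

/-- A multilinear sum over a box of integer vectors may be restricted to the monotone ones, provided
that each partial sum of a column is proportional to the preceding column. -/
theorem AlternatingMap.sum_monotone_eq {R V W : Type*} [CommRing R] [AddCommGroup V] [Module R V]
    [AddCommGroup W] [Module R W] {N : ℕ} (D : V [⋀^Fin N]→ₗ[R] W) (c : Fin N → ℤ → V) (L : ℤ)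
    (y : Fin N → ℤ) (hy : Monotone y)
    (hc : ∀ i j : Fin N, (i : ℕ) + 1 = j → ∀ k, k ≤ y i →
      ∃ s : R, ∑ v ∈ Finset.Ico L k, c j v = s • c i k)
    [DecidablePred fun u : Fin N → ℤ => Monotone u] :
    ∑ u ∈ (Finset.Icc (fun _ => L) y).filter (fun u => Monotone u), D (fun j => c j (u j)) =
      D (fun j => ∑ v ∈ Finset.Icc L (y j), c j v) := by
  classical
  have hall : D (fun j => ∑ v ∈ Finset.Icc L (y j), c j v) =
      ∑ u ∈ Finset.Icc (fun _ => L) y, D (fun j => c j (u j)) := by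
    rw [Pi.Icc_eq]
    exact D.toMultilinearMap.map_sum_finset c (fun j => Finset.Icc L (y j))
  rw [hall]
  -- Monotonicity is imposed one coordinate at a time: `P k` concerns only the first `k` entries.
  let P : ℕ → (Fin N → ℤ) → Prop := fun k u => ∀ i j : Fin N, i ≤ j → (j : ℕ) < k → u i ≤ u j
  have key : ∀ k ≤ N, ∑ u ∈ (Finset.Icc (fun _ => L) y).filter (P k), D (fun j => c j (u j)) =
      ∑ u ∈ Finset.Icc (fun _ => L) y, D (fun j => c j (u j)) := by
    intro k
    induction k with
    | zero =>
      intro _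
      rw [Finset.filter_true_of_mem]
      intro u _ i j _ h
      omega
    | succ k ih =>
      intro hk
      rw [← ih (by omega), ← Finset.sum_filter_add_sum_filter_not
        ((Finset.Icc (fun _ => L) y).filter (P k)) (P (k + 1)), Finset.filter_filter,
        Finset.filter_filter]
      have e : (Finset.Icc (fun _ => L) y).filter (fun u => P k u ∧ P (k + 1) u) =
          (Finset.Icc (fun _ => L) y).filter (P (k + 1)) := by
        apply Finset.filter_congr
        intro u _
        exact ⟨fun h => h.2, fun h => ⟨fun i j hij hj => h i j hij (by omega), h⟩⟩
      rw [e, left_eq_add]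
      rcases Nat.eq_zero_or_pos k with rfl | hk0
      · apply Finset.sum_eq_zero
        intro u hu
        exfalso
        refine (Finset.mem_filter.1 hu).2.2 fun i j hij hj => ?_
        rw [show i = j from le_antisymm hij (Fin.le_def.2 (by omega))]
      let i₀ : Fin N := ⟨k - 1, by omega⟩
      let j₀ : Fin N := ⟨k, by omega⟩
      have hne : i₀ ≠ j₀ := by
        intro h
        have := congrArg Fin.val h
        simp only [i₀, j₀] at this
        omega
      have bad : ∀ u, (P k u ∧ ¬ P (k + 1) u) ↔ (P k u ∧ u j₀ < u i₀) := by
        intro u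
        refine and_congr_right fun h => ⟨fun h' => ?_, fun h' h'' => ?_⟩
        · by_contra hlt
          refine h' fun i j hij hj => ?_
          by_cases hjk : (j : ℕ) < k
          · exact h i j hij hjk
          have hj0 : j = j₀ := Fin.ext (by simp only [j₀]; omega)
          subst hj0
          rcases eq_or_lt_of_le hij with rfl | hlt'
          · rfl
          · refine (h i i₀ ?_ ?_).trans (not_lt.1 hlt)
            · rw [Fin.lt_def] at hlt'; rw [Fin.le_def]; simp only [i₀, j₀] at *; omega
            · simp only [i₀]; omega
        · have := h'' i₀ j₀ (by rw [Fin.le_def]; simp only [i₀, j₀]; omega) (by simp [j₀])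
          omega
      set B := (Finset.Icc (fun _ => L) y).filter (fun u => P k u ∧ ¬ P (k + 1) u) with hB
      -- The bad vectors are grouped by all coordinates except `j₀`; overwriting that coordinate
      -- with `0` is merely a label for the group.
      rw [← Finset.sum_fiberwise_of_maps_to (t := B.image fun u => Function.update u j₀ 0)
        (g := fun u => Function.update u j₀ 0) (fun u hu => Finset.mem_image_of_mem _ hu)]
      apply Finset.sum_eq_zero
      intro w hw
      obtain ⟨u, hu, rfl⟩ := Finset.mem_image.1 hw
      have hmem : ∀ u, u ∈ B ↔ ((fun _ => L) ≤ u ∧ u ≤ y) ∧ P k u ∧ u j₀ < u i₀ := by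
        intro u
        rw [hB, Finset.mem_filter, Finset.mem_Icc, bad]
      have huB := (hmem u).1 hu
      obtain ⟨s, hs⟩ := hc i₀ j₀ (by simp only [i₀, j₀]; omega) (u i₀) (huB.1.2 i₀)
      have hfib : ∑ u' ∈ B.filter (fun u' => Function.update u' j₀ 0 = Function.update u j₀ 0),
          D (fun j => c j (u' j)) =
          ∑ v ∈ Finset.Ico L (u i₀), D (Function.update (fun j => c j (u j)) j₀ (c j₀ v)) := by
        symm
        refine Finset.sum_bij' (fun v _ => Function.update u j₀ v) (fun u' _ => u' j₀)
          ?_ ?_ ?_ ?_ ?_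
        · intro v hv
          rw [Finset.mem_Ico] at hv
          rw [Finset.mem_filter, hmem]
          refine ⟨⟨⟨?_, ?_⟩, ?_, ?_⟩, by simp⟩
          · intro j
            rcases eq_or_ne j j₀ with rfl | hj
            · simpa using hv.1
            · simpa [hj] using huB.1.1 j
          · intro j
            rcases eq_or_ne j j₀ with rfl | hj
            -- The bound `y j₀` holds automatically, as `v < u i₀ ≤ y i₀ ≤ y j₀`; hence the fibre is
            -- the whole interval `[L, u i₀)`.
            · simpa using (hv.2.le.trans (huB.1.2 i₀)).trans
                (hy (by rw [Fin.le_def]; simp only [i₀, j₀]; omega))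
            · simpa [hj] using huB.1.2 j
          · intro i j hij hj
            have h1 : j ≠ j₀ := by rintro rfl; simp [j₀] at hj
            have h2 : i ≠ j₀ := by
              rintro rfl
              rw [Fin.le_def] at hij; simp only [j₀] at hij; omega
            simpa [h1, h2] using huB.2.1 i j hij hj
          · simpa [hne] using hv.2
        · intro u' hu'
          rw [Finset.mem_filter, hmem] at hu'
          rw [Finset.mem_Ico]
          refine ⟨hu'.1.1.1 j₀, ?_⟩
          have := congrFun hu'.2 i₀
          simp only [Function.update_of_ne hne] at this
          rw [← this]
          exact hu'.1.2.2
        · intro v _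
          simp
        · intro u' hu'
          have := congrArg (fun f => Function.update f j₀ (u' j₀)) (Finset.mem_filter.1 hu').2
          simpa using this.symm
        · intro v _
          congr 1
          ext j
          rcases eq_or_ne j j₀ with rfl | hj
          · simp
          · simp [hj]
      -- The summed column `j₀` is a multiple of column `i₀`, so the alternating map vanishes.
      rw [hfib, ← AlternatingMap.map_update_sum, hs, AlternatingMap.map_update_smul,
        show c i₀ (u i₀) = (fun j => c j (u j)) i₀ from rfl,
        AlternatingMap.map_update_self _ _ hne.symm, smul_zero]
  rw [← key N le_rfl]
  refine Finset.sum_congr (Finset.filter_congr fun u _ => ?_) fun _ _ => rfl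
  exact ⟨fun h i j hij _ => h hij, fun h i j hij => h i j hij j.2⟩

/-! ### The forward equation for abstract determinants -/

/-- The weight of `v` in one time step of the growth process that leads to `y`, without the factors
which depend on the end points only. -/
noncomputable def stepWeight {N : ℕ} (a : ℂ) (β : ℕ → ℂ) (y : Fin N → ℤ) (j : Fin N) (v : ℤ) : ℂ :=
  if h : 0 < (j : ℕ) then
    a ^ (y j - max v (y ⟨j - 1, by omega⟩)) * β j ^ (max v (y ⟨j - 1, by omega⟩) - v)
  else a ^ (y j - v)

/-- The summand is the forward difference of `v ↦ β ^ (e - v + 1) * ψ v`. -/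
theorem sum_Ico_telescope {ψ : ℤ → ℂ} {β : ℂ} (hβ : β ≠ 0) {L : ℤ} (h0 : ψ L = 0) (e : ℤ)
    {k : ℤ} (hk : L ≤ k) :
    ∑ v ∈ Finset.Ico L k, β ^ (e - v) * (ψ (v + 1) - β * ψ v) = β ^ (e - k + 1) * ψ k := by
  induction k, hk using Int.leInduction with
  | base => simp [h0]
  | succ k hk ih =>
    rw [← Finset.insert_Ico_right_eq_Ico_add_one hk, Finset.sum_insert (by simp), ih,
      show e - k + 1 = (e - k) + 1 by ring, show e - (k + 1) + 1 = e - k by ring,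
      zpow_add_one₀ hβ]
    ring

/-- The summand is the forward difference of `v ↦ a ^ (e - v + 1) * ψ' (v - 1)`. -/
theorem sum_Ico_geometric {ψ ψ' : ℤ → ℂ} {a : ℂ} (ha : a ≠ 0) {L : ℤ} (h0 : ∀ n ≤ L, ψ' n = 0)
    (h : ∀ n, ψ' n - a * ψ' (n - 1) = ψ n) (e : ℤ) {k : ℤ} (hk : L ≤ k) :
    ∑ v ∈ Finset.Ico L k, a ^ (e - v) * ψ v = a ^ (e - k + 1) * ψ' (k - 1) := by
  induction k, hk using Int.leInduction with
  | base => simp [h0 (L - 1) (by omega)]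
  | succ k hk ih =>
    rw [← Finset.insert_Ico_right_eq_Ico_add_one hk, Finset.sum_insert (by simp), ih,
      show e - (k + 1) + 1 = e - k by ring, show e - k + 1 = (e - k) + 1 by ring,
      zpow_add_one₀ ha, ← h k, add_sub_cancel_right]
    ring

/-- One time step for determinants: the columns `ψ j` are obtained from each other by a difference
operator, and `ψ'` is obtained from `ψ` by geometric summation. -/
theorem sum_det_mul_stepWeight {N : ℕ} {a : ℂ} (ha : a ≠ 0) {β : ℕ → ℂ} (hβ : ∀ j, β j ≠ 0)
    {ψ ψ' : ℕ → Fin N → ℤ → ℂ}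
    (hψ : ∀ j i n, ψ (j + 1) i n = ψ j i (n + 1) - β (j + 1) * ψ j i n)
    (hψ' : ∀ j i n, ψ' (j + 1) i n = ψ' j i (n + 1) - β (j + 1) * ψ' j i n)
    (h : ∀ j i n, ψ' j i n - a * ψ' j i (n - 1) = ψ j i n) {L : ℤ}
    (h0 : ∀ j < N, ∀ i, ∀ n ≤ L, ψ j i n = 0) (h0' : ∀ j < N, ∀ i, ∀ n ≤ L, ψ' j i n = 0)
    {y : Fin N → ℤ} (hy : Monotone y) (hL : ∀ j, L ≤ y j)
    [DecidablePred fun u : Fin N → ℤ => Monotone u] :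
    ∑ u ∈ (Finset.Icc (fun _ => L) y).filter (fun u => Monotone u),
      (Matrix.of fun i j : Fin N => ψ j i (u j)).det * ∏ j, stepWeight a β y j (u j) =
      (Matrix.of fun i j : Fin N => ψ' j i (y j)).det := by
  have key := AlternatingMap.sum_monotone_eq (Matrix.detRowAlternating (R := ℂ) (n := Fin N))
    (fun j v i => stepWeight a β y j v * ψ j i v) L y hy ?_
  · have e1 : ∀ u : Fin N → ℤ, (Matrix.of fun i j : Fin N => ψ j i (u j)).det *
        ∏ j, stepWeight a β y j (u j) =
        Matrix.detRowAlternating (fun j i => stepWeight a β y j (u j) * ψ j i (u j)) := by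
      intro u
      rw [mul_comm, ← Matrix.det_mul_row, ← Matrix.det_transpose]
      rfl
    rw [Finset.sum_congr rfl fun u _ => e1 u, key]
    have e2 : Matrix.detRowAlternating
        (fun j => ∑ v ∈ Finset.Icc L (y j), fun i => stepWeight a β y j v * ψ j i v) =
        (Matrix.of fun i j : Fin N => ∑ v ∈ Finset.Icc L (y j),
          stepWeight a β y j v * ψ j i v).det := by
      rw [← Matrix.det_transpose]
      show Matrix.det _ = _
      congr 1
      ext j i
      simp [Finset.sum_apply]
    rw [e2]
    symm
    cases N with
    | zero => simp
    | succ n =>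
      -- Each new column is the summed column plus this multiple of the preceding new column, so the
      -- two determinants agree.
      refine Matrix.det_eq_of_forall_col_eq_smul_add_pred
        (fun j => a ^ (y j.succ - y j.castSucc) * (a - β (j + 1))) ?_ ?_
      · intro i
        have := sum_Ico_geometric ha (h0' 0 (by omega) i) (h 0 i) (y 0) (k := y 0 + 1)
          (by have := hL 0; omega)
        rw [Finset.Ico_add_one_right_eq_Icc] at this
        simp [stepWeight, this]
      · intro i j
        have hlt : (j : ℕ) + 1 < n + 1 := by omega
        have hyj : y j.castSucc ≤ y j.succ := hy (Fin.castSucc_lt_succ).le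
        have hw : ∀ v, stepWeight a β y j.succ v =
            a ^ (y j.succ - max v (y j.castSucc)) * β (j + 1) ^ (max v (y j.castSucc) - v) := by
          intro v
          simp only [stepWeight, Fin.val_succ, Nat.succ_pos, dif_pos, Nat.add_sub_cancel]
          rfl
        simp only [Matrix.of_apply, hw, Fin.val_succ, Fin.val_castSucc]
        set Y := y j.castSucc
        set y' := y j.succ
        have hLY : L ≤ Y := hL _
        -- At `Y` the maximum in the weight changes branch: up to `Y` the powers of `β` telescope,
        -- beyond it only powers of `a` remain.
        have split : Finset.Icc L y' = Finset.Ico L (Y + 1) ∪ Finset.Ico (Y + 1) (y' + 1) := by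
          rw [Finset.Ico_union_Ico_eq_Ico (by omega) (by omega),
            Finset.Ico_add_one_right_eq_Icc]
        have disj := Finset.Ico_disjoint_Ico_consecutive L (Y + 1) (y' + 1)
        have s1 : ∑ v ∈ Finset.Ico L (Y + 1),
            a ^ (y' - max v Y) * β (j + 1) ^ (max v Y - v) * ψ (j + 1) i v =
            a ^ (y' - Y) * ψ j i (Y + 1) := by
          have := sum_Ico_telescope (hβ (j + 1)) (h0 j (by omega) i L le_rfl) Y
            (k := Y + 1) (by omega)
          rw [show Y - (Y + 1) + 1 = 0 by ring, zpow_zero, one_mul] at this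
          rw [← this, Finset.mul_sum]
          refine Finset.sum_congr rfl fun v hv => ?_
          rw [Finset.mem_Ico] at hv
          rw [max_eq_right (by omega), hψ, mul_assoc]
        have s2 : ∑ v ∈ Finset.Ico (Y + 1) (y' + 1),
            a ^ (y' - max v Y) * β (j + 1) ^ (max v Y - v) * ψ (j + 1) i v =
            ψ' (j + 1) i y' - a ^ (y' - Y) * ψ' (j + 1) i Y := by
          have g1 := sum_Ico_geometric ha (h0' (j + 1) hlt i) (h (j + 1) i) y'
            (k := y' + 1) (by omega)
          have g2 := sum_Ico_geometric ha (h0' (j + 1) hlt i) (h (j + 1) i) y'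
            (k := Y + 1) (by omega)
          rw [Finset.Ico_add_one_right_eq_Icc, split, Finset.sum_union disj, g2] at g1
          rw [show y' - (y' + 1) + 1 = 0 by ring, zpow_zero, one_mul, add_sub_cancel_right,
            add_sub_cancel_right, show y' - (Y + 1) + 1 = y' - Y by ring] at g1
          rw [eq_sub_iff_add_eq, ← g1, add_comm]
          congr 1
          refine Finset.sum_congr rfl fun v hv => ?_
          rw [Finset.mem_Ico] at hv
          rw [max_eq_left (by omega), sub_self, zpow_zero, mul_one]
        rw [split, Finset.sum_union disj, s1, s2, ← h, hψ' j i Y, add_sub_cancel_right]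
        ring
  · intro i j hij k hk
    rcases lt_or_ge k L with hkL | hkL
    · exact ⟨0, by rw [Finset.Ico_eq_empty_of_le hkL.le]; simp⟩
    have hwt : stepWeight a β y i k ≠ 0 := by
      unfold stepWeight
      split_ifs
      · exact mul_ne_zero (zpow_ne_zero _ ha) (zpow_ne_zero _ (hβ _))
      · exact zpow_ne_zero _ ha
    -- For `v < k ≤ y i` the maximum in the weight is `y i`, so the partial sum telescopes to a
    -- multiple of `ψ i k`. Dividing by the nonzero weight of column `i` gives the scalar.
    refine ⟨a ^ (y j - y i) * β j ^ (y i - k + 1) * (stepWeight a β y i k)⁻¹, ?_⟩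
    ext r
    have ht := sum_Ico_telescope (hβ j) (h0 i i.2 r L le_rfl) (y i) hkL
    simp only [Finset.sum_apply, Pi.smul_apply, smul_eq_mul]
    rw [mul_assoc, inv_mul_cancel_left₀ hwt, mul_assoc, ← ht, Finset.mul_sum]
    refine Finset.sum_congr rfl fun v hv => ?_
    rw [Finset.mem_Ico] at hv
    have hi : (⟨(j : ℕ) - 1, by omega⟩ : Fin N) = i := Fin.ext (by simp only; omega)
    rw [stepWeight, dif_pos (by omega), hi, max_eq_right (by omega), ← hij, hψ, mul_assoc]

/-! ### Contour integrals of the kernel -/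

/-- The circle can be enlarged without changing the integral, and on a circle of large radius `R'`
the integrand is at most `ε / R'`, against a length of `2πR'`. -/
theorem circleIntegral_eq_zero_of_tendsto_cobounded {f : ℂ → ℂ} {R : ℝ} (hR : 0 < R)
    (hf : ∀ z, R ≤ ‖z‖ → DifferentiableAt ℂ f z)
    (hlim : Filter.Tendsto (fun z => z * f z) (Bornology.cobounded ℂ) (nhds 0)) :
    ∮ z in C(0, R), f z = 0 := by
  have bound : ∀ ε > 0, ‖∮ z in C(0, R), f z‖ ≤ 2 * Real.pi * ε := by
    intro ε hε
    obtain ⟨r, -, hr⟩ := ((Metric.hasBasis_cobounded_compl_closedBall (0 : ℂ)).eventually_iff).1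
      (Metric.tendsto_nhds.1 hlim ε hε)
    set R' := max R (r + 1) with hR'
    have hRR' : R ≤ R' := le_max_left _ _
    have hR'0 : 0 < R' := hR.trans_le hRR'
    have e := Complex.circleIntegral_eq_of_differentiable_on_annulus_off_countable hR hRR'
      Set.countable_empty (f := f) (c := 0)
      (fun z hz => (hf z (by simpa using hz.2)).continuousAt.continuousWithinAt)
      (fun z hz => hf z (by
        have := hz.1.2
        simp only [Metric.mem_closedBall, dist_zero_right, not_le] at this
        exact this.le))
    rw [← e]
    have := circleIntegral.norm_integral_le_of_norm_le_const (f := f) (c := 0) hR'0.le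
      (C := ε / R') (fun z hz => ?_)
    · refine this.trans (le_of_eq ?_)
      field_simp
    · have hz' : ‖z‖ = R' := by simpa using hz
      have := hr (x := z) (by
        simp only [Set.mem_compl_iff, Metric.mem_closedBall, dist_zero_right, not_le, hz']
        exact (lt_add_one r).trans_le (le_max_right _ _))
      rw [dist_zero_right, norm_mul, hz'] at this
      rw [le_div_iff₀ hR'0]
      linarith
  by_contra h
  have hpos := norm_pos_iff.2 h
  have := bound (‖∮ z in C(0, R), f z‖ / (4 * Real.pi)) (by positivity)
  have hpi := Real.pi_pos
  have e : 2 * Real.pi * (‖∮ z in C(0, R), f z‖ / (4 * Real.pi)) =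
    ‖∮ z in C(0, R), f z‖ / 2 := by field_simp; ring
  rw [e] at this
  linarith

/-- The integrand of the contour integrals for the transition probabilities, without the factors
that do not depend on the integration variable. -/
noncomputable def kernelIntegrand (a β : ℕ → ℂ) (m i j : ℕ) (e : ℤ) (z : ℂ) : ℂ :=
  z ^ e * ((∏ k ∈ Finset.range (j + 1), (z - β k)) / ∏ k ∈ Finset.range (i + 1), (z - β k)) *
    ∏ k ∈ Finset.range m, (1 - a k / z)⁻¹

/-- The contour integral of `kernelIntegrand` over the circle `|z| = R`. -/
noncomputable def kernelCoeff (a β : ℕ → ℂ) (R : ℝ) (m i j : ℕ) (e : ℤ) : ℂ :=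
  (2 * (Real.pi : ℂ) * Complex.I)⁻¹ * ∮ z in C(0, R), kernelIntegrand a β m i j (e - 1) z

section
variable {a β : ℕ → ℂ} {R : ℝ} {m i : ℕ}

theorem kernelIntegrand_differentiableAt {j : ℕ} {e : ℤ} {z : ℂ} (hz : z ≠ 0)
    (hβ : ∀ k ≤ i, z ≠ β k) (ha : ∀ k < m, z ≠ a k) :
    DifferentiableAt ℂ (kernelIntegrand a β m i j e) z := by
  unfold kernelIntegrand
  have h1 : ∏ k ∈ Finset.range (i + 1), (z - β k) ≠ 0 := by
    refine Finset.prod_ne_zero_iff.2 fun k hk => sub_ne_zero.2 (hβ k ?_)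
    rw [Finset.mem_range] at hk
    omega
  have h2 : ∀ k ∈ Finset.range m, DifferentiableAt ℂ (fun z => (1 - a k / z)⁻¹) z := by
    intro k hk
    refine DifferentiableAt.inv (by fun_prop (disch := assumption)) ?_
    rw [sub_ne_zero, ne_comm, Ne, div_eq_one_iff_eq hz, ← Ne, ne_comm]
    exact ha k (Finset.mem_range.1 hk)
  have h3 : DifferentiableAt ℂ (fun z => ∏ k ∈ Finset.range m, (1 - a k / z)⁻¹) z := by
    refine DifferentiableAt.fun_finsetProd h2
  refine DifferentiableAt.mul (DifferentiableAt.mul (differentiableAt_zpow.2 (Or.inl hz)) ?_) h3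
  exact DifferentiableAt.div (DifferentiableAt.fun_finsetProd fun k _ => by fun_prop)
    (DifferentiableAt.fun_finsetProd fun k _ => by fun_prop) h1

theorem kernelIntegrand_differentiableAt_of_le (hR : 0 < R) (hβ : ∀ k ≤ i, ‖β k‖ < R)
    (ha : ∀ k, ‖a k‖ < R) {j : ℕ} {e : ℤ} {z : ℂ} (hz : R ≤ ‖z‖) :
    DifferentiableAt ℂ (kernelIntegrand a β m i j e) z := by
  refine kernelIntegrand_differentiableAt (norm_pos_iff.1 (hR.trans_le hz)) ?_ ?_
  · rintro k hk rfl
    exact absurd (hβ k hk) (not_lt.2 hz)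
  · rintro k hk rfl
    exact absurd (ha k) (not_lt.2 hz)

theorem kernelIntegrand_circleIntegrable (hR : 0 < R) (hβ : ∀ k ≤ i, ‖β k‖ < R)
    (ha : ∀ k, ‖a k‖ < R) {j : ℕ} {e : ℤ} :
    CircleIntegrable (kernelIntegrand a β m i j e) 0 R := by
  refine ContinuousOn.circleIntegrable hR.le fun z hz => ?_
  have : R ≤ ‖z‖ := by simpa using (mem_sphere_zero_iff_norm.1 hz).ge
  exact (kernelIntegrand_differentiableAt_of_le hR hβ ha this).continuousAt.continuousWithinAt

/-- The extra factor `z - β (j + 1)` in the integrand acts as a shift of the exponent minus a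
scalar. -/
theorem kernelCoeff_succ_column (hR : 0 < R) (hβ : ∀ k ≤ i, ‖β k‖ < R) (ha : ∀ k, ‖a k‖ < R)
    (j : ℕ) (e : ℤ) : kernelCoeff a β R m i (j + 1) e =
      kernelCoeff a β R m i j (e + 1) - β (j + 1) * kernelCoeff a β R m i j e := by
  unfold kernelCoeff
  rw [mul_left_comm, ← mul_sub, ← smul_eq_mul (β (j + 1)), ← circleIntegral.integral_smul,
    ← circleIntegral.integral_sub (kernelIntegrand_circleIntegrable hR hβ ha)
      ((kernelIntegrand_circleIntegrable hR hβ ha).const_fun_smul (a := β (j + 1)))]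
  congr 1
  refine circleIntegral.integral_congr hR.le fun z hz => ?_
  have hz0 : z ≠ 0 := by
    rintro rfl
    simp only [mem_sphere_zero_iff_norm, norm_zero] at hz
    exact hR.ne hz
  simp only [kernelIntegrand, smul_eq_mul]
  rw [Finset.prod_range_succ _ (j + 1), add_sub_right_comm, zpow_add_one₀ hz0]
  ring

/-- Multiplying the integrand by `1 - a m / z` cancels the factor added by the last time step. -/
theorem kernelCoeff_succ_time (hR : 0 < R) (hβ : ∀ k ≤ i, ‖β k‖ < R) (ha : ∀ k, ‖a k‖ < R)
    (j : ℕ) (e : ℤ) : kernelCoeff a β R (m + 1) i j e -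
      a m * kernelCoeff a β R (m + 1) i j (e - 1) = kernelCoeff a β R m i j e := by
  unfold kernelCoeff
  rw [mul_left_comm, ← mul_sub, ← smul_eq_mul (a m), ← circleIntegral.integral_smul,
    ← circleIntegral.integral_sub (kernelIntegrand_circleIntegrable hR hβ ha)
      ((kernelIntegrand_circleIntegrable hR hβ ha).const_fun_smul (a := a m))]
  congr 1
  refine circleIntegral.integral_congr hR.le fun z hz => ?_
  have hz' : ‖z‖ = R := mem_sphere_zero_iff_norm.1 hz
  have hz0 : z ≠ 0 := norm_pos_iff.1 (hz' ▸ hR)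
  have h1 : 1 - a m / z ≠ 0 := by
    rw [sub_ne_zero, ne_comm, Ne, div_eq_one_iff_eq hz0]
    rintro rfl
    exact (ha m).ne hz'
  simp only [kernelIntegrand, smul_eq_mul]
  rw [Finset.prod_range_succ (fun k => (1 - a k / z)⁻¹) m, zpow_sub_one₀ hz0 (e - 1)]
  generalize ∏ k ∈ Finset.range m, (1 - a k / z)⁻¹ = A
  generalize (∏ k ∈ Finset.range (j + 1), (z - β k)) / ∏ k ∈ Finset.range (i + 1), (z - β k) = B
  calc _ = z ^ (e - 1) * B * A * ((1 - a m / z) * (1 - a m / z)⁻¹) := by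
        rw [div_eq_mul_inv]; ring
    _ = _ := by rw [mul_inv_cancel₀ h1, mul_one]

theorem tendsto_sub_div_self_cobounded (c : ℂ) :
    Filter.Tendsto (fun z : ℂ => (z - c) / z) (Bornology.cobounded ℂ) (nhds 1) := by
  have h : Filter.Tendsto (fun z : ℂ => 1 - c * z⁻¹) (Bornology.cobounded ℂ) (nhds 1) := by
    simpa using (tendsto_const_nhds (x := (1 : ℂ))).sub
      (Filter.tendsto_inv₀_cobounded.const_mul c)
  refine h.congr' ?_
  filter_upwards [Bornology.eventually_ne_cobounded (0 : ℂ)] with z hz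
  field_simp

/-- The contour integral vanishes when the integrand decays faster than `1 / z` at infinity. -/
theorem kernelCoeff_eq_zero (hR : 0 < R) (hβ : ∀ k ≤ i, ‖β k‖ < R) (ha : ∀ k, ‖a k‖ < R)
    {j : ℕ} {e : ℤ} (he : e + j < i) : kernelCoeff a β R m i j e = 0 := by
  unfold kernelCoeff
  rw [circleIntegral_eq_zero_of_tendsto_cobounded hR
    (fun z hz => kernelIntegrand_differentiableAt_of_le hR hβ ha hz), mul_zero]
  obtain ⟨p, hp⟩ : ∃ p : ℕ, e + j - i = -((p + 1 : ℕ) : ℤ) := ⟨(i - e - j - 1).toNat, by omega⟩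
  have hprod : ∀ n : ℕ, Filter.Tendsto (fun z : ℂ => ∏ k ∈ Finset.range n, ((z - β k) / z))
      (Bornology.cobounded ℂ) (nhds 1) := by
    intro n
    simpa using tendsto_finsetProd (Finset.range n)
      fun k _ => tendsto_sub_div_self_cobounded (β k)
  have hpow : Filter.Tendsto (fun z : ℂ => z⁻¹ ^ (p + 1)) (Bornology.cobounded ℂ) (nhds 0) := by
    simpa using (Filter.tendsto_inv₀_cobounded (α := ℂ)).pow (p + 1)
  have hlast : Filter.Tendsto (fun z : ℂ => ∏ k ∈ Finset.range m, (1 - a k / z)⁻¹)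
      (Bornology.cobounded ℂ) (nhds 1) := by
    have : ∀ k, Filter.Tendsto (fun z : ℂ => (1 - a k / z)⁻¹) (Bornology.cobounded ℂ)
        (nhds 1) := by
      intro k
      have h : Filter.Tendsto (fun z : ℂ => 1 - a k * z⁻¹) (Bornology.cobounded ℂ) (nhds 1) := by
        simpa using (tendsto_const_nhds (x := (1 : ℂ))).sub
          (Filter.tendsto_inv₀_cobounded.const_mul (a k))
      simpa [div_eq_mul_inv] using h.inv₀ one_ne_zero
    simpa using tendsto_finsetProd (Finset.range m) fun k _ => this k
  have := (hpow.mul ((hprod (j + 1)).div (hprod (i + 1)) one_ne_zero)).mul hlast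
  simp only [zero_mul] at this
  refine this.congr' ?_
  filter_upwards [Bornology.eventually_ne_cobounded (0 : ℂ)] with z hz
  simp only [kernelIntegrand, Pi.div_apply, Finset.prod_div_distrib, Finset.prod_const,
    Finset.card_range]
  have hz1 : z ^ (e - 1) = z⁻¹ ^ (p + 1) * z ^ (i + 1) / z ^ (j + 1) * z⁻¹ := by
    have : e - 1 = -((p + 1 : ℕ) : ℤ) + ((i + 1 : ℕ) : ℤ) - ((j + 1 : ℕ) : ℤ) - 1 := by
      push_cast at *; omega
    rw [this, zpow_sub_one₀ hz, zpow_sub₀ hz, zpow_add₀ hz, zpow_neg, zpow_natCast, zpow_natCast,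
      zpow_natCast, inv_pow]
  rw [hz1, div_div_div_eq]
  field_simp

/-- At time `0` the contour integral vanishes when the integrand is a polynomial. -/
theorem kernelCoeff_zero_eq_zero (hR : 0 < R) (hβ : ∀ k ≤ i, ‖β k‖ < R) {j : ℕ} (hij : i ≤ j)
    {e : ℤ} (he : 0 < e) : kernelCoeff a β R 0 i j e = 0 := by
  obtain ⟨p, rfl⟩ : ∃ p : ℕ, e = p + 1 := ⟨(e - 1).toNat, by omega⟩
  unfold kernelCoeff
  have hpoly : ∮ z in C(0, R), kernelIntegrand a β 0 i j ((p : ℤ) + 1 - 1) z =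
      ∮ z in C(0, R), z ^ p * ∏ k ∈ Finset.Ico (i + 1) (j + 1), (z - β k) := by
    refine circleIntegral.integral_congr hR.le fun z hz => ?_
    have hz' : ‖z‖ = R := mem_sphere_zero_iff_norm.1 hz
    have h1 : ∏ k ∈ Finset.range (i + 1), (z - β k) ≠ 0 := by
      refine Finset.prod_ne_zero_iff.2 fun k hk => sub_ne_zero.2 ?_
      rintro rfl
      exact (hβ k (by rw [Finset.mem_range] at hk; omega)).ne hz'
    simp only [kernelIntegrand, add_sub_cancel_right, zpow_natCast, Finset.range_zero,
      Finset.prod_empty, mul_one]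
    rw [← Finset.prod_range_mul_prod_Ico _ (show i + 1 ≤ j + 1 by omega),
      mul_div_cancel_left₀ _ h1]
  rw [hpoly, Complex.circleIntegral_eq_zero_of_differentiable_on_off_countable hR.le
    Set.countable_empty, mul_zero]
  · fun_prop
  · intro z _
    exact ((differentiable_id.pow p).mul
      (Differentiable.fun_finsetProd fun k _ => by fun_prop)).differentiableAt

theorem kernelCoeff_zero_self (hR : 0 < R) (hβ : ∀ k ≤ i, ‖β k‖ < R) :
    kernelCoeff a β R 0 i i 0 = 1 := by
  unfold kernelCoeff
  have : ∮ z in C(0, R), kernelIntegrand a β 0 i i (0 - 1) z = ∮ z in C(0, R), (z - 0)⁻¹ := by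
    refine circleIntegral.integral_congr hR.le fun z hz => ?_
    have hz' : ‖z‖ = R := mem_sphere_zero_iff_norm.1 hz
    have h1 : ∏ k ∈ Finset.range (i + 1), (z - β k) ≠ 0 := by
      refine Finset.prod_ne_zero_iff.2 fun k hk => sub_ne_zero.2 ?_
      rintro rfl
      exact (hβ k (by rw [Finset.mem_range] at hk; omega)).ne hz'
    simp [kernelIntegrand, div_self h1]
  rw [this, circleIntegral.integral_sub_inv_of_mem_ball (by simpa using hR)]
  exact inv_mul_cancel₀ Complex.two_pi_I_ne_zero

end

/-! ### One-step probabilities and the initial condition -/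

/-- The weight that the site with index `j` must have in a time step from `v` to `y`. -/
def stepIncrement {N : ℕ} (y : Fin N → ℤ) (j : Fin N) (v : ℤ) : ℤ :=
  if h : 0 < (j : ℕ) then y j - max v (y ⟨j - 1, by omega⟩) else y j - v

theorem stepIncrement_nonneg {N : ℕ} {y : Fin N → ℤ} (hy : Monotone y) {j : Fin N} {v : ℤ}
    (hv : v ≤ y j) : 0 ≤ stepIncrement y j v := by
  unfold stepIncrement
  split_ifs with h
  · have : y ⟨j - 1, by omega⟩ ≤ y j := hy (Fin.le_def.2 (by simp))
    have := max_le hv this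
    omega
  · omega

/-- This matches the algebraic column weights with the geometric law: the powers of `b j` outside
the maximum come from the endpoint factors of the determinant. -/
theorem zpow_mul_stepWeight {N : ℕ} (a : ℂ) {b : ℕ → ℂ} (hb : ∀ j, b j ≠ 0) (y : Fin N → ℤ)
    (j : Fin N) (v : ℤ) : b j ^ (y j - v) * stepWeight a (fun k => 1 / b k) y j v =
      (a * b j) ^ stepIncrement y j v := by
  unfold stepWeight stepIncrement
  split_ifs
  · generalize y ⟨j - 1, _⟩ = Y
    simp only [one_div]
    rw [mul_zpow, inv_zpow', mul_left_comm, ← zpow_add₀ (hb _)]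
    congr 2
    ring
  · rw [mul_zpow, mul_comm]

/-- The probability of a time step from `v` to `y` with parameters `a` and `b`. -/
noncomputable def stepProb {N : ℕ} (a : ℝ) (b : ℕ → ℝ) (v y : Fin N → ℤ) : ℝ :=
  ∏ j : Fin N, (1 - a * b j) * (a * b j) ^ (stepIncrement y j (v j)).toNat

/-- Compare the last coordinates. If that of `y` is smaller, the last row vanishes; if it is larger,
the last column does; if they agree, the last row is zero up to a final `1`, and expansion along it
lowers `N`. -/
theorem det_eq_ite_of_vanishing {N : ℕ} {K : ℕ → ℕ → ℤ → ℂ}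
    (hneg : ∀ i < N, ∀ (j : ℕ) (e : ℤ), e + j < i → K i j e = 0)
    (hpos : ∀ i < N, ∀ (j : ℕ) (e : ℤ), i ≤ j → 0 < e → K i j e = 0)
    (hself : ∀ i < N, K i i 0 = 1) {x y : Fin N → ℤ} (hx : Monotone x) (hy : Monotone y) :
    (Matrix.of fun i j : Fin N => K i j (y j - x i)).det = if y = x then 1 else 0 := by
  induction N with
  | zero => simp [Subsingleton.elim y x]
  | succ n ih =>
    rcases lt_trichotomy (y (Fin.last n)) (x (Fin.last n)) with h | h | h
    · rw [if_neg (by rintro rfl; exact h.false)]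
      refine Matrix.det_eq_zero_of_row_eq_zero (Fin.last n) fun j => ?_
      have := hy (Fin.le_last j)
      exact hneg _ (by simp) _ _ (by simp only [Fin.val_last]; omega)
    · have hrow : ∀ j : Fin n, K n j (y j.castSucc - x (Fin.last n)) = 0 := by
        intro j
        have := hy (Fin.le_last j.castSucc)
        exact hneg _ (by simp) _ _ (by omega)
      rw [Matrix.det_succ_row _ (Fin.last n), Fin.sum_univ_castSucc,
        Finset.sum_eq_zero fun j _ => by simp [hrow j], zero_add]
      have hsub : (Matrix.of fun i j : Fin (n + 1) => K i j (y j - x i)).submatrix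
          (Fin.last n).succAbove (Fin.last n).succAbove =
          Matrix.of fun i j : Fin n => K i j ((y ∘ Fin.castSucc) j - (x ∘ Fin.castSucc) i) := by
        ext i j
        simp
      rw [hsub, ih (fun i hi => hneg i (by omega)) (fun i hi => hpos i (by omega))
        (fun i hi => hself i (by omega)) (hx.comp Fin.strictMono_castSucc.monotone)
        (hy.comp Fin.strictMono_castSucc.monotone)]
      simp only [Fin.val_last, Matrix.of_apply, h, sub_self, hself n (by omega)]
      rw [← two_mul, pow_mul]
      have hiff : y ∘ Fin.castSucc = x ∘ Fin.castSucc ↔ y = x := by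
        refine ⟨fun h' => funext fun j => ?_, fun h' => h' ▸ rfl⟩
        exact Fin.lastCases h (fun j => congrFun h' j) j
      simp [hiff]
    · rw [if_neg (by rintro rfl; exact h.false)]
      refine Matrix.det_eq_zero_of_column_eq_zero (Fin.last n) fun i => ?_
      have := hx (Fin.le_last i)
      exact hpos _ i.2 _ _ (by simp only [Fin.val_last]; omega) (by omega)

/-! ### Determinants of the transition matrices -/

section
variable {N : ℕ} {a b : ℕ → ℝ} {R : ℝ}

theorem transitionMatrix_apply (hR : 0 < R) (m : ℕ) (x y : Fin N → ℤ) (i j : Fin N) :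
    transitionMatrix N a b R m x y i j =
      ((b i : ℂ) ^ x i)⁻¹ * (((b j : ℂ) ^ y j * ∏ k ∈ Finset.range m, (1 - (a k : ℂ) * b j)) *
        kernelCoeff (fun k => (a k : ℂ)) (fun k => 1 / (b k : ℂ)) R m i j (y j - x i)) := by
  simp only [transitionMatrix, Matrix.of_apply, kernelCoeff]
  rw [mul_left_comm _ (2 * (Real.pi : ℂ) * Complex.I)⁻¹,
    mul_left_comm _ (2 * (Real.pi : ℂ) * Complex.I)⁻¹, ← mul_assoc (_)⁻¹ _ (circleIntegral _ _ _),
    ← smul_eq_mul (_ * _) (circleIntegral _ _ _), ← circleIntegral.integral_smul]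
  congr 1
  refine circleIntegral.integral_congr hR.le fun z hz => ?_
  have hz0 : z ≠ 0 := norm_pos_iff.1 (by rw [mem_sphere_zero_iff_norm.1 hz]; exact hR)
  simp only [kernelIntegrand, smul_eq_mul, div_eq_mul_inv, Finset.prod_mul_distrib, mul_zpow,
    zpow_sub_one₀ hz0, zpow_sub₀ hz0, mul_inv]
  ring

/-- Factors independent of `z` depend on the row or the column alone and leave the determinant. -/
theorem det_transitionMatrix (hR : 0 < R) (m : ℕ) (x y : Fin N → ℤ) :
    (transitionMatrix N a b R m x y).det =
      (∏ i : Fin N, ((b i : ℂ) ^ x i)⁻¹) * ((∏ j : Fin N, ((b j : ℂ) ^ y j *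
        ∏ k ∈ Finset.range m, (1 - (a k : ℂ) * b j))) *
        (Matrix.of fun i j : Fin N => kernelCoeff (fun k => (a k : ℂ)) (fun k => 1 / (b k : ℂ))
          R m i j (y j - x i)).det) := by
  rw [← Matrix.det_mul_row, ← Matrix.det_mul_column]
  congr 1
  ext i j
  simp [transitionMatrix_apply hR]

theorem norm_one_div_lt (hb : ∀ j, 0 < b j) (hbR : ∀ j : Fin N, 1 / b j < R) {i : ℕ} (hi : i < N) :
    ∀ k ≤ i, ‖(1 / (b k : ℂ))‖ < R := by
  intro k hk
  simpa [abs_of_pos (hb k)] using hbR ⟨k, by omega⟩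

theorem det_transitionMatrix_zero (hb : ∀ j, 0 < b j) (hR : 0 < R)
    (hbR : ∀ j : Fin N, 1 / b j < R) (ha : ∀ k, |a k| < R)
    {x y : Fin N → ℤ} (hx : Monotone x) (hy : Monotone y) :
    (transitionMatrix N a b R 0 x y).det = if y = x then 1 else 0 := by
  have ha' : ∀ k, ‖(a k : ℂ)‖ < R := fun k => by simpa using ha k
  rw [det_transitionMatrix hR, det_eq_ite_of_vanishing
    (K := kernelCoeff (fun k => (a k : ℂ)) (fun k => 1 / (b k : ℂ)) R 0)
    (fun i hi j e he => kernelCoeff_eq_zero hR (norm_one_div_lt hb hbR hi) ha' he)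
    (fun i hi j e hij he => kernelCoeff_zero_eq_zero hR (norm_one_div_lt hb hbR hi) hij he)
    (fun i hi => kernelCoeff_zero_self hR (norm_one_div_lt hb hbR hi)) hx hy]
  split_ifs with h
  · subst h
    simp only [Finset.range_zero, Finset.prod_empty, mul_one, ← Finset.prod_mul_distrib]
    refine Finset.prod_eq_one fun j _ => inv_mul_cancel₀ (zpow_ne_zero _ ?_)
    exact_mod_cast (hb j).ne'
  · simp

/-- The forward equation for the determinants of the matrices `transitionMatrix`. -/
theorem sum_det_transitionMatrix_mul_stepProb (hb : ∀ j, 0 < b j) (hR : 0 < R)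
    (hbR : ∀ j : Fin N, 1 / b j < R) (ha : ∀ k, |a k| < R) {m : ℕ} (ham : a m ≠ 0)
    {x y : Fin N → ℤ} (hy : Monotone y) {L : ℤ} (hLx : ∀ i, L + N ≤ x i) (hLy : ∀ j, L ≤ y j)
    [DecidablePred fun u : Fin N → ℤ => Monotone u] :
    ∑ v ∈ (Finset.Icc (fun _ => L) y).filter (fun v => Monotone v),
      (transitionMatrix N a b R m x v).det * (stepProb (a m) b v y : ℂ) =
      (transitionMatrix N a b R (m + 1) x y).det := by
  have ha' : ∀ k, ‖(a k : ℂ)‖ < R := fun k => by simpa using ha k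
  have hb' : ∀ j, (b j : ℂ) ≠ 0 := fun j => by exact_mod_cast (hb j).ne'
  have hβ : ∀ i : Fin N, _ := fun i => norm_one_div_lt hb hbR i.2
  have key := sum_det_mul_stepWeight (N := N) (a := a m) (by exact_mod_cast ham)
    (β := fun k => 1 / (b k : ℂ)) (fun j => one_div_ne_zero (hb' j))
    (ψ := fun j i n => kernelCoeff (fun k => (a k : ℂ)) (fun k => 1 / (b k : ℂ)) R m i j (n - x i))
    (ψ' := fun j i n =>
      kernelCoeff (fun k => (a k : ℂ)) (fun k => 1 / (b k : ℂ)) R (m + 1) i j (n - x i))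
    (fun j i n => by rw [kernelCoeff_succ_column hR (hβ i) ha', add_sub_right_comm])
    (fun j i n => by rw [kernelCoeff_succ_column hR (hβ i) ha', add_sub_right_comm])
    (fun j i n => by
      rw [← kernelCoeff_succ_time (m := m) hR (hβ i) ha', sub_right_comm])
    (L := L)
    -- For `n ≤ L` the exponent `n - x i` is at most `-N`, so `j < N` forces the decay condition;
    -- this is why `L + N ≤ x i` is required.
    (fun j hj i n hn => kernelCoeff_eq_zero hR (hβ i) ha' (by have := hLx i; omega))
    (fun j hj i n hn => kernelCoeff_eq_zero hR (hβ i) ha' (by have := hLx i; omega))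
    hy hLy
  rw [det_transitionMatrix hR (m + 1), ← key, Finset.mul_sum, Finset.mul_sum]
  refine Finset.sum_congr rfl fun v hv => ?_
  rw [Finset.mem_filter, Finset.mem_Icc] at hv
  -- The powers `b j ^ (y j - v j)` convert the endpoint factors at `v` into those at `y`.
  have hq : (stepProb (a m) b v y : ℂ) = ∏ j : Fin N, ((1 - (a m : ℂ) * b j) *
      ((b j : ℂ) ^ (y j - v j) * stepWeight (a m) (fun k => 1 / (b k : ℂ)) y j (v j))) := by
    rw [stepProb, Complex.ofReal_prod]
    refine Finset.prod_congr rfl fun j _ => ?_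
    rw [zpow_mul_stepWeight (a m : ℂ) hb']
    lift stepIncrement y j (v j) to ℕ using stepIncrement_nonneg hy (hv.1.2 j) with n
    push_cast
    simp
  rw [det_transitionMatrix hR, hq]
  simp only [Finset.prod_range_succ, Finset.prod_mul_distrib, zpow_sub₀ (hb' _),
    Finset.prod_div_distrib]
  have hne : ∏ j : Fin N, (b j : ℂ) ^ v j ≠ 0 :=
    Finset.prod_ne_zero_iff.2 fun j _ => zpow_ne_zero _ (hb' j)
  field_simp

end

/-! ### The growth recursion -/

theorem maxBoundary_eq_right {c : WithBot ℤ} {k : ℤ} (h : c ≤ (k : WithBot ℤ)) :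
    maxBoundary c k = k := by
  induction c with
  | bot => rfl
  | coe d => exact max_eq_right (WithBot.coe_le_coe.1 h)

section growth
variable {c : WithBot ℤ} {x : ℕ → ℤ}

theorem le_growth (hc : c ≤ (x 0 : WithBot ℤ)) (w : ℕ → ℕ → ℕ) (m : ℕ) :
    x 0 ≤ growth c x w m 0 := by
  induction m with
  | zero => rw [growth]
  | succ m ih =>
    rw [growth, maxBoundary_eq_right (hc.trans (WithBot.coe_le_coe.2 ih))]
    omega

/-- The first site never drops below its initial value, which is at least `c`, so the boundary never
decides the maximum. -/
theorem growth_succ_zero (hc : c ≤ (x 0 : WithBot ℤ)) (w : ℕ → ℕ → ℕ) (m : ℕ) :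
    growth c x w (m + 1) 0 = growth c x w m 0 + w m 0 := by
  rw [growth, maxBoundary_eq_right (hc.trans (WithBot.coe_le_coe.2 (le_growth hc w m)))]

theorem growth_succ_succ (w : ℕ → ℕ → ℕ) (m n : ℕ) : growth c x w (m + 1) (n + 1) =
    max (growth c x w m (n + 1)) (growth c x w (m + 1) n) + w m (n + 1) := by
  rw [growth]

theorem growth_monotone_right (hx : Monotone x) (w : ℕ → ℕ → ℕ) (m : ℕ) :
    Monotone (growth c x w m) := by
  cases m with
  | zero =>
    intro i j h
    simpa [growth] using hx h
  | succ m =>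
    refine monotone_nat_of_le_succ fun n => ?_
    rw [growth_succ_succ]
    omega

theorem growth_monotone_left (hc : c ≤ (x 0 : WithBot ℤ)) (w : ℕ → ℕ → ℕ) (n : ℕ) :
    Monotone fun m => growth c x w m n := by
  refine monotone_nat_of_le_succ fun m => ?_
  cases n with
  | zero => rw [growth_succ_zero hc]; omega
  | succ n => rw [growth_succ_succ]; omega

theorem monotone_growthVec_apply (hx : Monotone x) (N : ℕ) (w : ℕ → ℕ → ℕ) (m : ℕ) :
    Monotone (growthVec N c x w m) :=
  fun _ _ h => growth_monotone_right hx w m h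

theorem growthVec_monotone (hc : c ≤ (x 0 : WithBot ℤ)) (N : ℕ) (w : ℕ → ℕ → ℕ) :
    Monotone (growthVec N c x w) :=
  fun _ _ h j => growth_monotone_left hc w j h

/-- The recursion can be solved for the weights; conversely, prescribed weights determine the new
row site by site, each from its left neighbour. -/
theorem growthVec_succ_eq_iff (hc : c ≤ (x 0 : WithBot ℤ)) {N : ℕ} (w : ℕ → ℕ → ℕ) (m : ℕ)
    (y : Fin N → ℤ) : growthVec N c x w (m + 1) = y ↔
      ∀ j : Fin N, (w m j : ℤ) = stepIncrement y j (growthVec N c x w m j) := by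
  constructor
  · rintro rfl ⟨j, hj⟩
    cases j with
    | zero => simp [stepIncrement, growthVec, growth_succ_zero hc]
    | succ n => simp [stepIncrement, growthVec, growth_succ_succ]
  · intro h
    have key : ∀ n (hn : n < N), growth c x w (m + 1) n = y ⟨n, hn⟩ := by
      intro n
      induction n with
      | zero =>
        intro hn
        have := h ⟨0, hn⟩
        simp only [stepIncrement, growthVec, lt_irrefl, dif_neg, not_false_eq_true] at this
        rw [growth_succ_zero hc, this]
        ring
      | succ n ih =>
        intro hn
        have := h ⟨n + 1, hn⟩
        simp only [stepIncrement, growthVec, Nat.succ_pos, dif_pos, Nat.add_sub_cancel] at this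
        rw [growth_succ_succ, this, ih (by omega)]
        ring
    exact funext fun j => key j j.2

/-- Only rows before `m` are assumed measurable, and the σ-algebra is arbitrary, so that the lemma
applies to the σ-algebra of the past. -/
theorem measurable_growth {Ω : Type*} [MeasurableSpace Ω] {ω : ℕ → ℕ → Ω → ℕ} {m : ℕ}
    (h : ∀ i < m, ∀ j, Measurable (ω i j)) (n : ℕ) :
    Measurable fun s => growth c x (fun i j => ω i j s) m n := by
  induction m generalizing n with
  | zero => simp [growth]
  | succ m ih =>
    have ih' := ih fun i hi j => h i (by omega) j
    have hw : ∀ j, Measurable fun s => (ω m j s : ℤ) := fun j =>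
      (measurable_of_countable _).comp (h m (by omega) j)
    induction n with
    | zero =>
      simp only [growth]
      exact ((measurable_of_countable (maxBoundary c)).comp (ih' 0)).add (hw 0)
    | succ n ihn =>
      simp only [growth_succ_succ]
      exact ((ih' (n + 1)).max ihn).add (hw (n + 1))

end growth

/-! ### Independence of the past and conditional laws -/

section markov
variable {Ω : Type*} {ω : ℕ → ℕ → Ω → ℕ}

/-- The σ-algebra generated by the weights used up to time `ℓ`. -/
abbrev pastSigma (ω : ℕ → ℕ → Ω → ℕ) (ℓ : ℕ) : MeasurableSpace Ω :=
  ⨆ p ∈ {p : ℕ × ℕ | p.1 < ℓ}, MeasurableSpace.comap (ω p.1 p.2) ⊤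

theorem pastSigma_le [mΩ : MeasurableSpace Ω] (hω : ∀ i j, Measurable (ω i j)) (ℓ : ℕ) : pastSigma ω ℓ ≤ mΩ :=
  iSup₂_le fun p _ => (hω p.1 p.2).comap_le

theorem pastSigma_mono {ℓ ℓ' : ℕ} (h : ℓ ≤ ℓ') : pastSigma ω ℓ ≤ pastSigma ω ℓ' :=
  biSup_mono fun _ hp => lt_of_lt_of_le hp h

theorem measurableSet_pastSigma_growthVec_eq {N : ℕ} {c : WithBot ℤ} {x : ℕ → ℤ} {k ℓ : ℕ}
    (hk : k ≤ ℓ) (v : Fin N → ℤ) :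
    MeasurableSet[pastSigma ω ℓ] {s | growthVec N c x (fun i j => ω i j s) k = v} := by
  have h : ∀ i < k, ∀ j, Measurable[pastSigma ω ℓ] (ω i j) := by
    intro i hi j
    rw [measurable_iff_comap_le]
    exact le_iSup₂_of_le (i, j) (show i < ℓ by omega) le_rfl
  have hG : Measurable[pastSigma ω ℓ] fun s => growthVec N c x (fun i j => ω i j s) k :=
    @measurable_pi_lambda _ _ _ (pastSigma ω ℓ) _ _ fun j =>
      @measurable_growth c x Ω (pastSigma ω ℓ) ω k h j
  exact hG (measurableSet_singleton v)

variable [MeasurableSpace Ω] {μ : Measure Ω}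

/-- The weights of row `ℓ` are independent of the past, and independent geometric. -/
theorem measureReal_inter_row_eq [IsProbabilityMeasure μ] {a b : ℕ → ℝ}
    (hω_meas : ∀ i j, Measurable (ω i j))
    (hω_indep : iIndepFun (fun p : ℕ × ℕ => ω p.1 p.2) μ)
    (hω_geom : ∀ i j k, μ.real {s | ω i j s = k} = (1 - a i * b j) * (a i * b j) ^ k)
    {N ℓ : ℕ} {B : Set Ω} (hB : MeasurableSet[pastSigma ω ℓ] B) (k : Fin N → ℕ) :
    μ.real (B ∩ {s | ∀ j : Fin N, ω ℓ j s = k j}) =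
      μ.real B * ∏ j : Fin N, (1 - a ℓ * b j) * (a ℓ * b j) ^ k j := by
  have hset : {s | ∀ j : Fin N, ω ℓ j s = k j} = ⋂ j : Fin N, {s | ω ℓ j s = k j} := by
    ext s; simp
  have hind := indep_iSup_of_disjoint (fun p : ℕ × ℕ => (hω_meas p.1 p.2).comap_le)
    hω_indep.iIndep (S := {p | p.1 < ℓ}) (T := {p | p.1 = ℓ})
    (Set.disjoint_left.2 fun p hp hp' => by
      simp only [Set.mem_ofPred_eq] at hp hp'
      omega)
  have hrow : MeasurableSet[⨆ p ∈ {p : ℕ × ℕ | p.1 = ℓ},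
      MeasurableSpace.comap (ω p.1 p.2) ⊤] (⋂ j : Fin N, {s | ω ℓ j s = k j}) := by
    refine MeasurableSet.iInter fun j => ?_
    have : MeasurableSpace.comap (ω ℓ j) ⊤ ≤
        ⨆ p ∈ {p : ℕ × ℕ | p.1 = ℓ}, MeasurableSpace.comap (ω p.1 p.2) ⊤ :=
      le_iSup₂_of_le (ℓ, (j : ℕ)) rfl le_rfl
    exact this _ ⟨{k j}, trivial, rfl⟩
  have hmul := (Indep_iff _ _ μ).1 hind B _ hB hrow
  have hpre : iIndepFun (fun j : Fin N => ω ℓ j) μ :=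
    hω_indep.precomp (g := fun j : Fin N => (ℓ, (j : ℕ)))
      (fun i j h => Fin.ext (Prod.mk.inj h).2)
  have hprod := hpre.meas_iInter
    (s := fun j : Fin N => {s | ω ℓ j s = k j}) (fun j => ⟨{k j}, trivial, rfl⟩)
  rw [hset, measureReal_def, hmul, hprod, ENNReal.toReal_mul, ENNReal.toReal_prod]
  congr 1
  exact Finset.prod_congr rfl fun j _ => hω_geom ℓ j (k j)

/-- The joint law of an event of the past and the state after `m` further steps. -/
theorem measureReal_inter_growthVec_eq [IsProbabilityMeasure μ] {a b : ℕ → ℝ}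
    (hω_meas : ∀ i j, Measurable (ω i j))
    (hω_indep : iIndepFun (fun p : ℕ × ℕ => ω p.1 p.2) μ)
    (hω_geom : ∀ i j k, μ.real {s | ω i j s = k} = (1 - a i * b j) * (a i * b j) ^ k)
    {x : ℕ → ℤ} (hx : Monotone x) {c : WithBot ℤ} (hc : c ≤ (x 0 : WithBot ℤ)) {N : ℕ} {R : ℝ}
    (hb : ∀ j, 0 < b j) (hR : 0 < R) (hbR : ∀ j : Fin N, 1 / b j < R) (ha : ∀ k, |a k| < R)
    (ha0 : ∀ k, a k ≠ 0) {ℓ : ℕ} {u : Fin N → ℤ} (hu : Monotone u) {B : Set Ω}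
    (hB : MeasurableSet[pastSigma ω ℓ] B)
    (hBu : ∀ s ∈ B, growthVec N c x (fun i j => ω i j s) ℓ = u) (m : ℕ) {y : Fin N → ℤ}
    (hy : Monotone y) :
    (μ.real (B ∩ {s | growthVec N c x (fun i j => ω i j s) (ℓ + m) = y}) : ℂ) =
      μ.real B * (transitionMatrix N (fun k => a (ℓ + k)) b R m u y).det := by
  classical
  induction m generalizing y with
  | zero =>
    rw [det_transitionMatrix_zero hb hR hbR (fun k => ha (ℓ + k)) hu hy]
    split_ifs with h
    · rw [Set.inter_eq_left.2 fun s hs => by simpa [h] using hBu s hs, mul_one]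
    · have : B ∩ {s | growthVec N c x (fun i j => ω i j s) (ℓ + 0) = y} = ∅ := by
        refine Set.eq_empty_of_forall_notMem fun s hs => h ?_
        rw [← hBu s hs.1]
        exact hs.2.symm
      rw [this]
      simp
  | succ m ih =>
    -- The box must lie `N` below `u`, where the kernel entries vanish, and also reach below `y`.
    obtain ⟨L, hL⟩ := (Set.finite_range fun i : Fin N => min (u i - N) (y i)).bddBelow
    have hLi : ∀ i, L + N ≤ u i ∧ L ≤ y i := fun i => by
      have := hL ⟨i, rfl⟩
      simp only at this
      omega
    rw [← sum_det_transitionMatrix_mul_stepProb hb hR hbR (fun k => ha (ℓ + k)) (ha0 (ℓ + m)) hy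
      (fun i => (hLi i).1) (fun i => (hLi i).2), Finset.mul_sum]
    have hB' : ∀ v : Fin N → ℤ, MeasurableSet[pastSigma ω (ℓ + m)]
        (B ∩ {s | growthVec N c x (fun i j => ω i j s) (ℓ + m) = v}) := fun v =>
      (pastSigma_mono (by omega) _ hB).inter (measurableSet_pastSigma_growthVec_eq le_rfl v)
    have hstep : ∀ v ≤ y, (B ∩ {s | growthVec N c x (fun i j => ω i j s) (ℓ + m) = v}) ∩
        {s | growthVec N c x (fun i j => ω i j s) (ℓ + (m + 1)) = y} =
        (B ∩ {s | growthVec N c x (fun i j => ω i j s) (ℓ + m) = v}) ∩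
          {s | ∀ j : Fin N, ω (ℓ + m) j s = (stepIncrement y j (v j)).toNat} := by
      intro v hv
      ext s
      refine and_congr_right fun hs => ?_
      rw [Set.mem_ofPred_eq, ← add_assoc, growthVec_succ_eq_iff hc, hs.2]
      refine forall_congr' fun j => ?_
      have := stepIncrement_nonneg hy (hv j)
      omega
    -- Growth in time traps the intermediate state between `u` and `y`, so finitely many monotone
    -- states suffice.
    have hunion : B ∩ {s | growthVec N c x (fun i j => ω i j s) (ℓ + (m + 1)) = y} =
        ⋃ v ∈ (Finset.Icc (fun _ => L) y).filter (fun v => Monotone v),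
          (B ∩ {s | growthVec N c x (fun i j => ω i j s) (ℓ + m) = v}) ∩
            {s | growthVec N c x (fun i j => ω i j s) (ℓ + (m + 1)) = y} := by
      ext s
      simp only [Set.mem_iUnion, exists_prop, Finset.mem_filter, Finset.mem_Icc]
      constructor
      · rintro ⟨hs, hs'⟩
        refine ⟨growthVec N c x (fun i j => ω i j s) (ℓ + m), ⟨⟨fun j => ?_, ?_⟩,
          monotone_growthVec_apply hx _ _ _⟩, ⟨hs, rfl⟩, hs'⟩
        · have h1 : growthVec N c x (fun i j => ω i j s) ℓ j ≤
              growthVec N c x (fun i j => ω i j s) (ℓ + m) j :=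
            growthVec_monotone hc N (fun i j => ω i j s) (by omega) j
          rw [hBu s hs] at h1
          have := (hLi j).1
          simp only
          omega
        · rw [← show growthVec N c x (fun i j => ω i j s) (ℓ + (m + 1)) = y from hs']
          exact growthVec_monotone hc N _ (by omega)
      · rintro ⟨v, -, hs, hs'⟩
        exact ⟨hs.1, hs'⟩
    have hmeas : ∀ v : Fin N → ℤ,
        MeasurableSet ((B ∩ {s | growthVec N c x (fun i j => ω i j s) (ℓ + m) = v}) ∩
          {s | growthVec N c x (fun i j => ω i j s) (ℓ + (m + 1)) = y}) := fun v =>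
      (pastSigma_le hω_meas _ _ (hB' v)).inter
        (pastSigma_le hω_meas _ _ (measurableSet_pastSigma_growthVec_eq le_rfl y))
    rw [hunion, measureReal_biUnion_finset ?_ fun v _ => hmeas v, Complex.ofReal_sum]
    · refine Finset.sum_congr rfl fun v hv => ?_
      rw [Finset.mem_filter, Finset.mem_Icc] at hv
      rw [hstep v hv.1.2, measureReal_inter_row_eq hω_meas hω_indep hω_geom (hB' v),
        Complex.ofReal_mul, ih hv.2, mul_assoc]
      rfl
    · intro v _ v' _ hne
      refine Set.disjoint_left.2 fun s hs hs' => hne ?_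
      exact hs.1.2.symm.trans hs'.1.2

/-- Division of the joint law by the mass of `B`. The event `B` is kept general so that it can be
either the whole path or the present state alone. -/
theorem cond_growthVec_eq_det [IsProbabilityMeasure μ] {a b : ℕ → ℝ}
    (hω_meas : ∀ i j, Measurable (ω i j))
    (hω_indep : iIndepFun (fun p : ℕ × ℕ => ω p.1 p.2) μ)
    (hω_geom : ∀ i j k, μ.real {s | ω i j s = k} = (1 - a i * b j) * (a i * b j) ^ k)
    {x : ℕ → ℤ} (hx : Monotone x) {c : WithBot ℤ} (hc : c ≤ (x 0 : WithBot ℤ)) {N : ℕ} {R : ℝ}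
    (hb : ∀ j, 0 < b j) (hR : 0 < R) (hbR : ∀ j : Fin N, 1 / b j < R) (ha : ∀ k, |a k| < R)
    (ha0 : ∀ k, a k ≠ 0) {ℓ : ℕ} {u : Fin N → ℤ} (hu : Monotone u) {B : Set Ω}
    (hB : MeasurableSet[pastSigma ω ℓ] B)
    (hBu : ∀ s ∈ B, growthVec N c x (fun i j => ω i j s) ℓ = u) (hB0 : μ B ≠ 0) (m : ℕ)
    {y : Fin N → ℤ} (hy : Monotone y) :
    ((μ[{s | growthVec N c x (fun i j => ω i j s) (ℓ + m) = y} | B]).toReal : ℂ) =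
      (transitionMatrix N (fun k => a (ℓ + k)) b R m u y).det := by
  have key := measureReal_inter_growthVec_eq hω_meas hω_indep hω_geom hx hc hb hR hbR ha ha0 hu hB
    hBu m hy
  have hne : (μ.real B : ℂ) ≠ 0 := by
    rw [Complex.ofReal_ne_zero, measureReal_def]
    exact (ENNReal.toReal_pos hB0 (measure_ne_top _ _)).ne'
  rw [cond_apply (pastSigma_le hω_meas _ _ hB), ENNReal.toReal_mul, ENNReal.toReal_inv,
    Complex.ofReal_mul, Complex.ofReal_inv]
  rw [measureReal_def, measureReal_def] at key
  rw [key, ← measureReal_def, inv_mul_cancel_left₀ hne]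

end markov

/-! ### The main theorem -/

theorem theorem1
    {Ω : Type*} [MeasurableSpace Ω] (μ : Measure Ω) [IsProbabilityMeasure μ]
    -- the parameters `a_i, b_j ∈ [0,1]` with `0 < a_i b_j < 1`
    (a b : ℕ → ℝ)
    (ha : ∀ i, a i ∈ Set.Icc (0 : ℝ) 1) (hb : ∀ j, b j ∈ Set.Icc (0 : ℝ) 1)
    (hab : ∀ i j, 0 < a i * b j ∧ a i * b j < 1)
    -- independent weights `ω(i,j) ∼ Geom(a_i b_j)`
    (ω : ℕ → ℕ → Ω → ℕ) (hω_meas : ∀ i j, Measurable (ω i j))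
    (hω_indep : iIndepFun (fun p : ℕ × ℕ => ω p.1 p.2) μ)
    (hω_geom : ∀ i j k, μ.real {s | ω i j s = k} = (1 - a i * b j) * (a i * b j) ^ k)
    -- the initial values `x_1 ≤ x_2 ≤ ⋯` and the boundary value `G(m,0) = c ≤ x_1`
    (x : ℕ → ℤ) (hx : Monotone x) (c : WithBot ℤ) (hc : c ≤ (x 0 : WithBot ℤ))
    (N : ℕ)
    -- the vector process
    (G : ℕ → Ω → Fin N → ℤ)
    (hG : ∀ m s, G m s = growthVec N c x (fun i j => ω i j s) m) :
    -- it takes values in the Weyl chamber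
    (∀ m s, G m s ∈ weylChamber N) ∧
    -- it is a Markov chain
    (∀ ℓ m : ℕ, ℓ ≤ m → ∀ (u : ℕ → Fin N → ℤ) (y : Fin N → ℤ),
      μ {s | ∀ k ≤ ℓ, G k s = u k} ≠ 0 →
        μ[{s | G m s = y} | {s | ∀ k ≤ ℓ, G k s = u k}] =
          μ[{s | G m s = y} | {s | G ℓ s = u ℓ}]) ∧
    -- the transition probability from time `0` to time `m`
    (∀ R : ℝ, (∀ j : Fin N, 1 / b j < R) → ∀ (m : ℕ), ∀ y ∈ weylChamber N,
      ((μ[{s | G m s = y} | {s | G 0 s = fun j : Fin N => x j}]).toReal : ℂ) =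
        (transitionMatrix N a b R m (fun j : Fin N => x j) y).det) ∧
    -- the transition probability from time `ℓ` to time `ℓ + m`
    (∀ R : ℝ, (∀ j : Fin N, 1 / b j < R) → ∀ (ℓ m : ℕ), ∀ u ∈ weylChamber N,
      ∀ y ∈ weylChamber N, μ {s | G ℓ s = u} ≠ 0 →
        ((μ[{s | G (ℓ + m) s = y} | {s | G ℓ s = u}]).toReal : ℂ) =
          (transitionMatrix N (fun k => a (ℓ + k)) b R m u y).det) := by
  obtain rfl : G = fun m s => growthVec N c x (fun i j => ω i j s) m :=
    funext fun m => funext fun s => hG m s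
  have hb0 : ∀ j, 0 < b j := fun j => pos_of_mul_pos_right (hab 0 j).1 (ha 0).1
  have ha0 : ∀ i, 0 < a i := fun i => pos_of_mul_pos_left (hab i 0).1 (hb 0).1
  have haR : ∀ R : ℝ, 1 < R → ∀ k, |a k| < R := fun R hR k => by
    rw [abs_of_pos (ha0 k)]
    exact (ha k).2.trans_lt hR
  have hW : ∀ m s, Monotone (growthVec N c x (fun i j => ω i j s) m) := fun m s =>
    monotone_growthVec_apply hx N _ m
  have formula : ∀ R : ℝ, (∀ j : Fin N, 1 / b j < R) → ∀ (ℓ m : ℕ), ∀ u ∈ weylChamber N,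
      ∀ y ∈ weylChamber N, ∀ B : Set Ω, MeasurableSet[pastSigma ω ℓ] B →
      (∀ s ∈ B, growthVec N c x (fun i j => ω i j s) ℓ = u) → μ B ≠ 0 →
      ((μ[{s | growthVec N c x (fun i j => ω i j s) (ℓ + m) = y} | B]).toReal : ℂ) =
        (transitionMatrix N (fun k => a (ℓ + k)) b R m u y).det := by
    intro R hR ℓ m u hu y hy B hB hBu hB0
    -- For `N = 0` the condition on `R` is empty and `R` may even be negative; both determinants are
    -- then `1`, so `R = 2` serves.
    rcases Nat.eq_zero_or_pos N with rfl | hN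
    · rw [cond_growthVec_eq_det hω_meas hω_indep hω_geom hx hc hb0 (R := 2) two_pos
        (fun j => j.elim0) (haR 2 one_lt_two) (fun k => (ha0 k).ne') hu hB hBu hB0 m hy,
        Matrix.det_isEmpty, Matrix.det_isEmpty]
    -- Since `b 0 ≤ 1`, the bound `1 / b 0 < R` gives `1 < R`, so the poles `a k` also lie inside
    -- the circle.
    · have hR1 : 1 < R := ((one_le_div (hb0 0)).2 (hb 0).2).trans_lt (hR ⟨0, hN⟩)
      exact cond_growthVec_eq_det hω_meas hω_indep hω_geom hx hc hb0 (by linarith) hR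
        (haR R hR1) (fun k => (ha0 k).ne') hu hB hBu hB0 m hy
  refine ⟨hW, ?_, ?_, ?_⟩
  · intro ℓ m hℓm u y hne
    obtain ⟨d, rfl⟩ := Nat.exists_eq_add_of_le hℓm
    have hsub : {s | ∀ k ≤ ℓ, growthVec N c x (fun i j => ω i j s) k = u k} ⊆
        {s | growthVec N c x (fun i j => ω i j s) ℓ = u ℓ} := fun s hs => hs ℓ le_rfl
    have hne' : μ {s | growthVec N c x (fun i j => ω i j s) ℓ = u ℓ} ≠ 0 :=
      fun h => hne (measure_mono_null hsub h)
    by_cases hy : Monotone y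
    · obtain ⟨s₀, hs₀⟩ := nonempty_of_measure_ne_zero hne
      have hu : Monotone (u ℓ) := hs₀ ℓ le_rfl ▸ hW ℓ s₀
      -- The Markov property involves no contour; any admissible radius will do.
      obtain ⟨R, hR⟩ := (Set.finite_range fun j : Fin N => 1 / b j).bddAbove
      have hR' : ∀ j : Fin N, 1 / b j < R + 1 := fun j => (hR ⟨j, rfl⟩).trans_lt (lt_add_one R)
      have hpath : MeasurableSet[pastSigma ω ℓ]
          {s | ∀ k ≤ ℓ, growthVec N c x (fun i j => ω i j s) k = u k} := by
        simp only [Set.ofPred_forall]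
        exact MeasurableSet.iInter fun k => MeasurableSet.iInter fun hk =>
          measurableSet_pastSigma_growthVec_eq hk (u k)
      rw [← ENNReal.toReal_eq_toReal_iff' (measure_ne_top _ _) (measure_ne_top _ _),
        ← Complex.ofReal_inj,
        formula (R + 1) hR' ℓ d (u ℓ) hu y hy _ hpath (fun s hs => hs ℓ le_rfl) hne,
        formula (R + 1) hR' ℓ d (u ℓ) hu y hy _ (measurableSet_pastSigma_growthVec_eq le_rfl _)
          (fun s hs => hs) hne']
    -- A state outside the Weyl chamber is never reached, and both conditional probabilities are
    -- zero.
    · have hempty : {s | growthVec N c x (fun i j => ω i j s) (ℓ + d) = y} = ∅ :=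
        Set.eq_empty_of_forall_notMem fun s hs => hy (hs ▸ hW (ℓ + d) s)
      simp only [hempty, measure_empty]
  · intro R hR m y hy
    have := formula R hR 0 m (fun j => x j) (fun i j h => hx h) y hy
      {s | growthVec N c x (fun i j => ω i j s) 0 = fun j : Fin N => x j}
      (measurableSet_pastSigma_growthVec_eq le_rfl _) (fun s hs => hs) ?_
    · simpa only [zero_add] using this
    · have huniv : {s | growthVec N c x (fun i j => ω i j s) 0 = fun j : Fin N => x j} =
          Set.univ := Set.eq_univ_of_forall fun s => funext fun j => by simp [growthVec, growth]
      rw [huniv, measure_univ]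
      exact one_ne_zero
  · intro R hR ℓ m u hu y hy hne
    exact formula R hR ℓ m u hu y hy _ (measurableSet_pastSigma_growthVec_eq le_rfl _)
      (fun s hs => hs) hne
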